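/- Conventions. An operator space is a linear subspace $E\subseteq\mathcal B(H)$ for some complex Hilbert space $H$; the norm on $M_n(E)\subseteq M_n(\mathcal B(H))=\mathcal B(H^n)$ is the operator norm. A linear map $\varphi:E\to F$ of operator spaces is completely contractive (completely isometric) if, for every $n$, the entrywise map $M_n(E)\to M_n(F)$, $(a_{ij})\mapsto(\varphi(a_{ij}))$, is contractive (isometric). An operator space $F$ is injective if for every inclusion $A\subseteq B$ of operator spaces, every completely contractive map $A\to F$ has a completely contractive extension $B\to F$. An injective envelope of $E$ is a pair $(F,\kappa)$ in which $F$ is an injective operator space, $\kappa:E\to F$ is a completely isometric linear map, and every injective operator space $F_0$ with $\kappa(E)\subseteq F_0\subseteq F$ equals $F$. Theorem (rigidity). Let $E$ be an operator space and let $(F,\kappa)$ be an injective envelope of $E$. Then the inclusion $\kappa(E)\subseteq F$ is rigid: the identity of $F$ is the only completely contractive map $\theta:F\to F$ with $\theta(\kappa(x))=\kappa(x)$ for all $x\in E$. -/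

import Mathlib

universe u v

/-- A (concrete) operator space on the Hilbert space `H`: a linear subspace of the bounded
operators on `H`. -/
abbrev OperatorSpace (H : Type u) [NormedAddCommGroup H] [InnerProductSpace ℂ H] : Type u :=
  Submodule ℂ (H →L[ℂ] H)

/-- The identification of an `n × n` matrix `a` of bounded operators on `H` with a bounded
operator on the Hilbert space direct sum of `n` copies of `H`, `(a x) i = ∑ j, a i j (x j)`. -/
noncomputable def matrixOperator {H : Type u} [NormedAddCommGroup H] [InnerProductSpace ℂ H]
    {n : ℕ} (a : Matrix (Fin n) (Fin n) (H →L[ℂ] H)) :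
    PiLp 2 (fun _ : Fin n => H) →L[ℂ] PiLp 2 (fun _ : Fin n => H) :=
  ((PiLp.continuousLinearEquiv 2 ℂ (fun _ : Fin n => H)).symm :
      (Fin n → H) →L[ℂ] PiLp 2 (fun _ : Fin n => H)) ∘L
    (ContinuousLinearMap.pi fun i =>
      ∑ j, a i j ∘L (ContinuousLinearMap.proj j : (Fin n → H) →L[ℂ] H)) ∘L
    ((PiLp.continuousLinearEquiv 2 ℂ (fun _ : Fin n => H)) :
      PiLp 2 (fun _ : Fin n => H) →L[ℂ] (Fin n → H))

theorem matrixOperator_apply {H : Type u} [NormedAddCommGroup H] [InnerProductSpace ℂ H]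
    {n : ℕ} (a : Matrix (Fin n) (Fin n) (H →L[ℂ] H)) (x : PiLp 2 (fun _ : Fin n => H))
    (i : Fin n) : matrixOperator a x i = ∑ j, a i j (x j) := by
  simp [matrixOperator]

/-- The norm of the matrix space `Mₙ(E)` of an operator space `E`, inherited from the operator
norm on `n × n` matrices of operators. -/
noncomputable def matrixNorm {H : Type u} [NormedAddCommGroup H] [InnerProductSpace ℂ H]
    {E : OperatorSpace H} {n : ℕ} (a : Matrix (Fin n) (Fin n) E) : ℝ :=
  ‖matrixOperator (a.map fun x : E => (x : H →L[ℂ] H))‖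

/-- A linear map between operator spaces is completely contractive if all its entrywise
amplifications `Mₙ(E) → Mₙ(F)` are contractions. -/
def IsCompletelyContractive
    {H : Type u} [NormedAddCommGroup H] [InnerProductSpace ℂ H] {E : OperatorSpace H}
    {K : Type v} [NormedAddCommGroup K] [InnerProductSpace ℂ K] {F : OperatorSpace K}
    (φ : E →ₗ[ℂ] F) : Prop :=
  ∀ (n : ℕ) (a : Matrix (Fin n) (Fin n) E), matrixNorm (a.map φ) ≤ matrixNorm a

/-- A linear map between operator spaces is completely isometric if all its entrywise
amplifications `Mₙ(E) → Mₙ(F)` are isometries. -/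
def IsCompletelyIsometric
    {H : Type u} [NormedAddCommGroup H] [InnerProductSpace ℂ H] {E : OperatorSpace H}
    {K : Type v} [NormedAddCommGroup K] [InnerProductSpace ℂ K] {F : OperatorSpace K}
    (φ : E →ₗ[ℂ] F) : Prop :=
  ∀ (n : ℕ) (a : Matrix (Fin n) (Fin n) E), matrixNorm (a.map φ) = matrixNorm a

/-- `F` is an injective object of the category of operator spaces and completely contractive
maps: for every inclusion `A ⊆ B` of operator spaces, every completely contractive map `A → F`
has a completely contractive extension `B → F`. -/
def IsInjectiveOperatorSpace
    {K : Type v} [NormedAddCommGroup K] [InnerProductSpace ℂ K] (F : OperatorSpace K) : Prop :=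
  ∀ (L : Type v) [NormedAddCommGroup L] [InnerProductSpace ℂ L] [CompleteSpace L]
    (A B : OperatorSpace L) (hAB : A ≤ B) (φ : A →ₗ[ℂ] F), IsCompletelyContractive φ →
    ∃ ψ : B →ₗ[ℂ] F, IsCompletelyContractive ψ ∧ ∀ x : A, ψ (Submodule.inclusion hAB x) = φ x

/-- `(F, κ)` is an injective envelope of `E`: `κ : E → F` is a completely isometric embedding,
`F` is injective, and no injective operator space other than `F` lies between `κ(E)` and `F`. -/
structure IsInjectiveEnvelope
    {H : Type u} [NormedAddCommGroup H] [InnerProductSpace ℂ H] (E : OperatorSpace H)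
    {K : Type v} [NormedAddCommGroup K] [InnerProductSpace ℂ K] (F : OperatorSpace K)
    (κ : E →ₗ[ℂ] F) : Prop where
  isometric : IsCompletelyIsometric κ
  injective : IsInjectiveOperatorSpace F
  minimal : ∀ F₀ : OperatorSpace K, (∀ x : E, (κ x : K →L[ℂ] K) ∈ F₀) → F₀ ≤ F →
    IsInjectiveOperatorSpace F₀ → F₀ = F

/-!
Injectivity of `F` yields a completely contractive retraction of all bounded operators on `K`
onto `F`. Call a completely contractive map `F → F` fixing `κ(E)` pointwise an admissible map, and
compare admissible maps `φ` through the seminorms `x ↦ ‖φ x‖`.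

* A chain of such seminorms has a lower bound: a limit of the maps along an ultrafilter, taken in
  the weak operator topology, is a completely contractive map into the bounded operators
  (`exists_ultralimit`), and the retraction brings it back into `F`. By Zorn's lemma there is an
  admissible `φ` whose seminorm is minimal (`exists_minimal_admissible`).
* For an admissible `ψ` the seminorm of `ψ ∘ φ` is at most that of `φ`, so by minimality `ψ` is
  isometric on the range of `φ`. Admissible maps form a convex semigroup; applying this to the
  Cesàro means of the powers of `φ`, whose values on `y - φ y` tend to zero, gives `φ ∘ φ = φ`
  (`eq_of_norm_admissible_eq`).
* The range of `φ` is injective (`isInjectiveOperatorSpace_range`), lies in `F` and contains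
  `κ(E)`; minimality of the injective envelope makes it all of `F`, hence `φ = id`. Now every
  admissible map is isometric on `F`, and the same Cesàro argument shows that it is the identity.
-/

open Filter Topology
open scoped InnerProductSpace

/-! ### Matrix norms and complete contractions -/

section MatrixNorm

variable {H : Type u} [NormedAddCommGroup H] [InnerProductSpace ℂ H]
  {K : Type v} [NormedAddCommGroup K] [InnerProductSpace ℂ K]

theorem matrixOperator_add {n : ℕ} (a b : Matrix (Fin n) (Fin n) (H →L[ℂ] H)) :
    matrixOperator (a + b) = matrixOperator a + matrixOperator b := by
  ext x i
  simp [matrixOperator_apply, Finset.sum_add_distrib]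

theorem matrixOperator_smul {n : ℕ} (c : ℂ) (a : Matrix (Fin n) (Fin n) (H →L[ℂ] H)) :
    matrixOperator (c • a) = c • matrixOperator a := by
  ext x i
  simp [matrixOperator_apply, Finset.smul_sum]

theorem norm_matrixOperator_one (T : H →L[ℂ] H) :
    ‖matrixOperator (fun _ _ : Fin 1 => T)‖ = ‖T‖ := by
  apply le_antisymm
  · refine ContinuousLinearMap.opNorm_le_bound _ (norm_nonneg _) fun x => ?_
    have h := matrixOperator_apply (fun _ _ : Fin 1 => T) x 0
    simp only [Fin.sum_univ_one] at h
    simpa [PiLp.norm_eq_of_L2, h] using T.le_opNorm (x 0)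
  · refine ContinuousLinearMap.opNorm_le_bound _ (ContinuousLinearMap.opNorm_nonneg _) fun x => ?_
    have h := matrixOperator_apply (fun _ _ : Fin 1 => T) (WithLp.toLp 2 fun _ => x) 0
    simp only [Fin.sum_univ_one] at h
    simpa [PiLp.norm_eq_of_L2, h] using
      (matrixOperator (fun _ _ : Fin 1 => T)).le_opNorm (WithLp.toLp 2 fun _ => x)

theorem matrixNorm_one {E : OperatorSpace H} (x : E) :
    matrixNorm (fun _ _ : Fin 1 => x) = ‖x‖ :=
  norm_matrixOperator_one (x : H →L[ℂ] H)

theorem matrixNorm_add_le {E : OperatorSpace H} {n : ℕ} (a b : Matrix (Fin n) (Fin n) E) :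
    matrixNorm (a + b) ≤ matrixNorm a + matrixNorm b := by
  unfold matrixNorm
  rw [show (a + b).map (fun x : E => (x : H →L[ℂ] H)) = a.map (fun x : E => (x : H →L[ℂ] H)) +
    b.map (fun x : E => (x : H →L[ℂ] H)) from rfl, matrixOperator_add]
  exact ContinuousLinearMap.opNorm_add_le _ _

theorem matrixNorm_smul_le {E : OperatorSpace H} {n : ℕ} (c : ℂ) (a : Matrix (Fin n) (Fin n) E) :
    matrixNorm (c • a) ≤ ‖c‖ * matrixNorm a := by
  unfold matrixNorm
  rw [show (c • a).map (fun x : E => (x : H →L[ℂ] H)) =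
    c • a.map (fun x : E => (x : H →L[ℂ] H)) from rfl, matrixOperator_smul]
  exact ContinuousLinearMap.opNorm_smul_le _ _

theorem norm_smul_operatorSpace {E : OperatorSpace H} (c : ℂ) (x : E) :
    ‖c • x‖ = ‖c‖ * ‖x‖ :=
  norm_smul c (x : H →L[ℂ] H)

theorem IsCompletelyContractive.norm_le {E : OperatorSpace H} {F : OperatorSpace K}
    {φ : E →ₗ[ℂ] F} (hφ : IsCompletelyContractive φ) (x : E) : ‖φ x‖ ≤ ‖x‖ := by
  rw [← matrixNorm_one x, ← matrixNorm_one (φ x)]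
  exact hφ 1 fun _ _ => x

theorem IsCompletelyContractive.comp {L : Type*} [NormedAddCommGroup L] [InnerProductSpace ℂ L]
    {E : OperatorSpace H} {F : OperatorSpace K} {G : OperatorSpace L}
    {ψ : F →ₗ[ℂ] G} {φ : E →ₗ[ℂ] F} (hψ : IsCompletelyContractive ψ)
    (hφ : IsCompletelyContractive φ) : IsCompletelyContractive (ψ ∘ₗ φ) :=
  fun n a => (hψ n (a.map φ)).trans (hφ n a)

/-- An inclusion of operator spaces preserves the norms of matrices, by definition of the latter. -/
theorem isCompletelyContractive_inclusion {E F : OperatorSpace H} (h : E ≤ F) :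
    IsCompletelyContractive (Submodule.inclusion h) :=
  fun _ _ => le_rfl

theorem isCompletelyContractive_id (E : OperatorSpace H) :
    IsCompletelyContractive (LinearMap.id : E →ₗ[ℂ] E) :=
  fun _ _ => le_rfl

end MatrixNorm

/-! ### Weak limits along an ultrafilter -/

section WeakLimit

variable {ι : Type*} {K : Type v} [NormedAddCommGroup K] [InnerProductSpace ℂ K]

/-- `w` is the limit of the family `v` along the filter `l` in the weak topology of `K`. -/
def TendstoWeakly (v : ι → K) (l : Filter ι) (w : K) : Prop :=
  ∀ η : K, Tendsto (fun i => ⟪v i, η⟫_ℂ) l (𝓝 ⟪w, η⟫_ℂ)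

theorem TendstoWeakly.add {v v' : ι → K} {l : Filter ι} {w w' : K} (h : TendstoWeakly v l w)
    (h' : TendstoWeakly v' l w') : TendstoWeakly (fun i => v i + v' i) l (w + w') := fun η => by
  simpa only [inner_add_left] using (h η).add (h' η)

theorem TendstoWeakly.smul {v : ι → K} {l : Filter ι} {w : K} (c : ℂ)
    (h : TendstoWeakly v l w) : TendstoWeakly (fun i => c • v i) l (c • w) := fun η => by
  simpa only [inner_smul_left] using (h η).const_mul _

theorem tendstoWeakly_const (l : Filter ι) (w : K) : TendstoWeakly (fun _ => w) l w :=
  fun _ => tendsto_const_nhds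

theorem TendstoWeakly.unique {v : ι → K} {l : Filter ι} [l.NeBot] {w w' : K}
    (h : TendstoWeakly v l w) (h' : TendstoWeakly v l w') : w = w' :=
  ext_inner_right ℂ fun η => tendsto_nhds_unique (h η) (h' η)

theorem TendstoWeakly.norm_le {v : ι → K} {l : Filter ι} [l.NeBot] {w : K}
    (h : TendstoWeakly v l w) {r : ℝ} (hr : ∀ᶠ i in l, ‖v i‖ ≤ r) : ‖w‖ ≤ r := by
  have h1 : ‖w‖ * ‖w‖ ≤ r * ‖w‖ := by
    have h2 : ‖⟪w, w⟫_ℂ‖ ≤ r * ‖w‖ := by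
      refine le_of_tendsto (h w).norm (hr.mono fun i hi => ?_)
      exact (norm_inner_le_norm _ _).trans (by gcongr)
    simpa [inner_self_eq_norm_sq_to_K, sq] using h2
  rcases (norm_nonneg w).eq_or_lt with h0 | h0
  · obtain ⟨i, hi⟩ := hr.exists
    exact h0 ▸ (norm_nonneg _).trans hi
  · exact le_of_mul_le_mul_right h1 h0

/-- Weak compactness of balls of a Hilbert space: the Banach–Alaoglu theorem, transported to `K`
by the Riesz representation. -/
theorem exists_tendstoWeakly [CompleteSpace K] (U : Ultrafilter ι) (v : ι → K) {r : ℝ}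
    (hr : ∀ i, ‖v i‖ ≤ r) : ∃ w, TendstoWeakly v U w := by
  let f : ι → WeakDual ℂ K := fun i => StrongDual.toWeakDual (InnerProductSpace.toDual ℂ K (v i))
  obtain ⟨g, -, hg⟩ := (WeakDual.isCompact_closedBall (𝕜 := ℂ) (E := K) 0 r).ultrafilter_le_nhds
    (U.map f) (by
      rw [Ultrafilter.coe_map, le_principal_iff]
      refine mem_map.2 (univ_mem' fun i => ?_)
      have : ‖InnerProductSpace.toDual ℂ K (v i)‖ ≤ r := by simpa using hr i
      simpa [f] using this)
  refine ⟨(InnerProductSpace.toDual ℂ K).symm (WeakDual.toStrongDual g), fun η => ?_⟩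
  have h := ((WeakDual.eval_continuous η).tendsto g).comp (show Tendsto f U (𝓝 g) from hg)
  rw [InnerProductSpace.toDual_symm_apply]
  exact h

theorem TendstoWeakly.matrixOperator {n : ℕ} {l : Filter ι}
    {a : ι → Matrix (Fin n) (Fin n) (K →L[ℂ] K)} {b : Matrix (Fin n) (Fin n) (K →L[ℂ] K)}
    (h : ∀ p q ξ, TendstoWeakly (fun i => a i p q ξ) l (b p q ξ))
    (x : PiLp 2 fun _ : Fin n => K) :
    TendstoWeakly (fun i => _root_.matrixOperator (a i) x) l (_root_.matrixOperator b x) := by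
  intro η
  simp only [PiLp.inner_apply, matrixOperator_apply, sum_inner]
  exact tendsto_finsetSum _ fun p _ => tendsto_finsetSum _ fun q _ => h p q (x q) (η p)

/-- Completely contractive maps into bounded operators have pointwise limits along an ultrafilter
in the weak operator topology, and these are completely contractive. -/
theorem exists_ultralimit [CompleteSpace K] {H : Type u} [NormedAddCommGroup H]
    [InnerProductSpace ℂ H] {E : OperatorSpace H} {F : OperatorSpace K} (U : Ultrafilter ι)
    (φ : ι → E →ₗ[ℂ] F) (hφ : ∀ i, IsCompletelyContractive (φ i)) :
    ∃ T : E →ₗ[ℂ] (⊤ : OperatorSpace K), IsCompletelyContractive T ∧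
      ∀ x ξ, TendstoWeakly (fun i => (φ i x : K →L[ℂ] K) ξ) U ((T x : K →L[ℂ] K) ξ) := by
  have hb : ∀ i x ξ, ‖(φ i x : K →L[ℂ] K) ξ‖ ≤ ‖x‖ * ‖ξ‖ := fun i x ξ =>
    ((φ i x : K →L[ℂ] K).le_opNorm ξ).trans
      (mul_le_mul_of_nonneg_right ((hφ i).norm_le x) (norm_nonneg ξ))
  choose w hw using fun x ξ => exists_tendstoWeakly U (fun i => (φ i x : K →L[ℂ] K) ξ)
    fun i => hb i x ξ
  let S : E → K →L[ℂ] K := fun x => LinearMap.mkContinuous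
    { toFun := w x
      map_add' := fun ξ ξ' => (hw x (ξ + ξ')).unique (by
        simpa only [map_add] using (hw x ξ).add (hw x ξ'))
      map_smul' := fun c ξ => (hw x (c • ξ)).unique (by
        simpa only [map_smul, RingHom.id_apply] using (hw x ξ).smul c) }
    ‖x‖ fun ξ => (hw x ξ).norm_le (Eventually.of_forall fun i => hb i x ξ)
  let T : E →ₗ[ℂ] (⊤ : OperatorSpace K) :=
    { toFun := fun x => ⟨S x, trivial⟩
      map_add' := fun x y => Subtype.ext <| ContinuousLinearMap.ext fun ξ =>
        (hw (x + y) ξ).unique (by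
          simp only [map_add]
          exact (hw x ξ).add (hw y ξ))
      map_smul' := fun c x => Subtype.ext <| ContinuousLinearMap.ext fun ξ =>
        (hw (c • x) ξ).unique (by
          simp only [map_smul]
          exact (hw x ξ).smul c) }
  refine ⟨T, fun n a => ?_, hw⟩
  refine ContinuousLinearMap.opNorm_le_bound _ (ContinuousLinearMap.opNorm_nonneg _) fun x => ?_
  refine (TendstoWeakly.matrixOperator
    (a := fun i => (a.map (φ i)).map fun y : F => (y : K →L[ℂ] K))
    (b := (a.map T).map fun y => (y : K →L[ℂ] K))
    (fun p q ξ => hw (a p q) ξ) x).norm_le (Eventually.of_forall fun i => ?_)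
  exact (ContinuousLinearMap.le_opNorm _ x).trans
    (mul_le_mul_of_nonneg_right (hφ i n a) (norm_nonneg x))

end WeakLimit

/-! ### Admissible maps -/

section Admissible

variable {K : Type v} [NormedAddCommGroup K] [InnerProductSpace ℂ K] {F : OperatorSpace K}

/-- A completely contractive map of `F` into itself that fixes every point of `X`. -/
def IsAdmissible (X : Set F) (φ : F →ₗ[ℂ] F) : Prop :=
  IsCompletelyContractive φ ∧ ∀ x ∈ X, φ x = x

theorem isAdmissible_id (X : Set F) : IsAdmissible X LinearMap.id :=
  ⟨isCompletelyContractive_id F, fun _ _ => rfl⟩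

theorem IsAdmissible.comp {X : Set F} {φ ψ : F →ₗ[ℂ] F} (hφ : IsAdmissible X φ)
    (hψ : IsAdmissible X ψ) : IsAdmissible X (φ ∘ₗ ψ) :=
  ⟨hφ.1.comp hψ.1, fun x hx => by simp [hψ.2 x hx, hφ.2 x hx]⟩

theorem IsAdmissible.pow {X : Set F} {φ : F →ₗ[ℂ] F} (hφ : IsAdmissible X φ) (n : ℕ) :
    IsAdmissible X (φ ^ n) := by
  induction n with
  | zero => exact isAdmissible_id X
  | succ n ih => exact pow_succ φ n ▸ ih.comp hφ

theorem IsAdmissible.convex {X : Set F} {φ ψ : F →ₗ[ℂ] F} (hφ : IsAdmissible X φ)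
    (hψ : IsAdmissible X ψ) {s t : ℝ} (hs : 0 ≤ s) (ht : 0 ≤ t) (hst : s + t = 1) :
    IsAdmissible X ((s : ℂ) • φ + (t : ℂ) • ψ) := by
  refine ⟨fun n a => ?_, fun x hx => ?_⟩
  · calc matrixNorm (a.map ((s : ℂ) • φ + (t : ℂ) • ψ : F →ₗ[ℂ] F))
        = matrixNorm ((s : ℂ) • a.map φ + (t : ℂ) • a.map ψ) := rfl
      _ ≤ matrixNorm ((s : ℂ) • a.map φ) + matrixNorm ((t : ℂ) • a.map ψ) :=
        matrixNorm_add_le _ _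
      _ ≤ s * matrixNorm (a.map φ) + t * matrixNorm (a.map ψ) := by
        refine add_le_add ((matrixNorm_smul_le _ _).trans_eq ?_)
          ((matrixNorm_smul_le _ _).trans_eq ?_)
        · rw [Complex.norm_of_nonneg hs]
        · rw [Complex.norm_of_nonneg ht]
      _ ≤ s * matrixNorm a + t * matrixNorm a := by
        gcongr
        · exact hφ.1 n a
        · exact hψ.1 n a
      _ = matrixNorm a := by rw [← add_mul, hst, one_mul]
  · rw [LinearMap.add_apply, LinearMap.smul_apply, LinearMap.smul_apply, hφ.2 x hx, hψ.2 x hx,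
      ← add_smul, ← Complex.ofReal_add, hst, Complex.ofReal_one, one_smul]

/-- The Cesàro mean of the first `n + 1` powers of an admissible map is admissible; on `y - θ y`
the sum telescopes. -/
theorem IsAdmissible.exists_cesaro {X : Set F} {θ : F →ₗ[ℂ] F} (hθ : IsAdmissible X θ) (n : ℕ) :
    ∃ ψ : F →ₗ[ℂ] F, IsAdmissible X ψ ∧
      ∀ y, ((n : ℂ) + 1) • ψ (y - θ y) = y - (θ ^ (n + 1)) y := by
  induction n with
  | zero => exact ⟨LinearMap.id, isAdmissible_id X, fun y => by simp⟩
  | succ n ih =>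
    obtain ⟨ψ, hψ, h⟩ := ih
    refine ⟨_, hψ.convex (hθ.pow (n + 1)) (s := (n + 1) / (n + 2)) (t := 1 / (n + 2))
      (by positivity) (by positivity) (by field_simp; ring), fun y => ?_⟩
    have h2 : (n : ℂ) + 2 ≠ 0 := by exact_mod_cast (by positivity : (n : ℝ) + 2 ≠ 0)
    have e1 : ((n + 1 : ℕ) + 1 : ℂ) * (((n + 1) / (n + 2) : ℝ) : ℂ) = n + 1 := by
      push_cast; field_simp; ring
    have e2 : ((n + 1 : ℕ) + 1 : ℂ) * ((1 / (n + 2) : ℝ) : ℂ) = 1 := by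
      push_cast; field_simp; ring
    rw [LinearMap.add_apply, LinearMap.smul_apply, LinearMap.smul_apply, smul_add, smul_smul,
      smul_smul, e1, e2, h, one_smul, map_sub, ← Module.End.mul_apply, ← pow_succ]
    abel

/-- Cesàro means of the powers of `θ` send `y - θ y` to vectors of norm at most `2‖y‖ / (n + 1)`,
so `y - θ y` vanishes as soon as admissible maps preserve its norm. -/
theorem eq_of_norm_admissible_eq {X : Set F} {θ : F →ₗ[ℂ] F} (hθ : IsAdmissible X θ) (y : F)
    (h : ∀ ψ, IsAdmissible X ψ → ‖y - θ y‖ ≤ ‖ψ (y - θ y)‖) : θ y = y := by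
  have key : ∀ n : ℕ, ‖y - θ y‖ ≤ 2 * ‖y‖ / ((n : ℝ) + 1) := fun n => by
    obtain ⟨ψ, hψ, e⟩ := hθ.exists_cesaro n
    have h1 : ‖(n : ℂ) + 1‖ * ‖ψ (y - θ y)‖ = ‖y - (θ ^ (n + 1)) y‖ :=
      (norm_smul_operatorSpace _ _).symm.trans (congrArg (fun z : F => ‖z‖) (e y))
    have h2 : ‖((n : ℂ) + 1)‖ = (n : ℝ) + 1 := by
      exact_mod_cast Complex.norm_natCast (n + 1)
    rw [h2] at h1
    have h3 := norm_sub_le y ((θ ^ (n + 1)) y)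
    have h4 := (hθ.pow (n + 1)).1.norm_le y
    rw [le_div_iff₀ (by positivity)]
    nlinarith [h ψ hψ, mul_le_mul_of_nonneg_left (h ψ hψ) (by positivity : (0 : ℝ) ≤ n + 1)]
  have hlim : Tendsto (fun n : ℕ => 2 * ‖y‖ / ((n : ℝ) + 1)) atTop (𝓝 0) := by
    simpa [div_eq_mul_inv] using (tendsto_one_div_add_atTop_nhds_zero_nat (𝕜 := ℝ)).const_mul
      (2 * ‖y‖)
  have h0 : ‖y - θ y‖ ≤ 0 := ge_of_tendsto' hlim key
  exact (sub_eq_zero.1 (norm_le_zero_iff.1 h0)).symm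

/-- An injective operator space is a completely contractive retract of the algebra of all bounded
operators. -/
theorem IsInjectiveOperatorSpace.exists_retraction [CompleteSpace K]
    (hF : IsInjectiveOperatorSpace F) :
    ∃ P : (⊤ : OperatorSpace K) →ₗ[ℂ] F, IsCompletelyContractive P ∧
      ∀ x : F, P ⟨x, trivial⟩ = x :=
  hF K F ⊤ le_top LinearMap.id (isCompletelyContractive_id F)

/-- Some admissible map `φ` of an injective operator space has a minimal seminorm
`x ↦ ‖φ x‖`. -/
theorem exists_minimal_admissible [CompleteSpace K] (hF : IsInjectiveOperatorSpace F)
    (X : Set F) : ∃ φ, IsAdmissible X φ ∧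
      ∀ ψ, IsAdmissible X ψ → (∀ x, ‖ψ x‖ ≤ ‖φ x‖) → ∀ x, ‖φ x‖ ≤ ‖ψ x‖ := by
  obtain ⟨P, hP, hPF⟩ := hF.exists_retraction
  let r : {φ // IsAdmissible X φ} → {φ // IsAdmissible X φ} → Prop :=
    fun φ ψ => ∀ x, ‖ψ.1 x‖ ≤ ‖φ.1 x‖
  have hchain : ∀ c, IsChain r c → ∃ ub, ∀ φ ∈ c, r φ ub := by
    intro c hc
    rcases c.eq_empty_or_nonempty with rfl | ⟨φ₀, hφ₀⟩
    · exact ⟨⟨_, isAdmissible_id X⟩, fun _ h => h.elim⟩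
    -- The tails of the chain generate a proper filter; the limit is taken along a finer ultrafilter.
    let l : Filter c := ⨅ φ : c, 𝓟 {ψ : c | r φ ψ}
    have hr : ∀ φ, r φ φ := fun _ _ => le_rfl
    have : Nonempty c := ⟨⟨φ₀, hφ₀⟩⟩
    have : l.NeBot := by
      refine iInf_neBot_of_directed (fun φ ψ => ?_) fun φ => ?_
      · have hφψ : r φ ψ ∨ r ψ φ := by
          rcases eq_or_ne φ.1 ψ.1 with h | h
          · exact .inl (h ▸ hr _)
          · exact hc φ.2 ψ.2 h
        rcases hφψ with h | h
        · exact ⟨ψ, le_principal_iff.2 fun χ hχ x => (hχ x).trans (h x), le_rfl⟩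
        · exact ⟨φ, le_rfl, le_principal_iff.2 fun χ hχ x => (hχ x).trans (h x)⟩
      · exact principal_neBot_iff.2 ⟨φ, hr φ⟩
    obtain ⟨T, hT, hlim⟩ := exists_ultralimit (Ultrafilter.of l) (fun φ : c => φ.1.1)
      fun φ => φ.1.2.1
    refine ⟨⟨P ∘ₗ T, hP.comp hT, fun x hx => ?_⟩, fun φ hφ x => (hP.norm_le _).trans ?_⟩
    · have : T x = ⟨x, trivial⟩ := Subtype.ext <| ContinuousLinearMap.ext fun ξ =>
        (hlim x ξ).unique (by
          simpa only [fun φ : c => φ.1.2.2 x hx] using tendstoWeakly_const _ _)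
      rw [LinearMap.comp_apply, this, hPF]
    · refine ContinuousLinearMap.opNorm_le_bound _ (norm_nonneg _) fun ξ => ?_
      have hev : ∀ᶠ ψ : c in l, r φ ψ :=
        mem_iInf_of_mem (⟨φ, hφ⟩ : c) (mem_principal_self _)
      refine (hlim x ξ).norm_le ((hev.filter_mono (Ultrafilter.of_le l)).mono fun ψ hψ => ?_)
      exact (ContinuousLinearMap.le_opNorm _ ξ).trans
        (mul_le_mul_of_nonneg_right (hψ x) (norm_nonneg ξ))
  obtain ⟨m, hm⟩ := exists_maximal_of_chains_bounded (r := r) hchain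
    fun {_ _ _} h1 h2 x => (h2 x).trans (h1 x)
  exact ⟨m.1, m.2, fun ψ hψ h => hm ⟨ψ, hψ⟩ h⟩

/-- The range of a completely contractive projection on an injective operator space is
injective. -/
theorem isInjectiveOperatorSpace_range (hF : IsInjectiveOperatorSpace F) {φ : F →ₗ[ℂ] F}
    (hφ : IsCompletelyContractive φ) (hid : ∀ x, φ (φ x) = φ x) :
    IsInjectiveOperatorSpace ((LinearMap.range φ).map F.subtype) := by
  intro L _ _ _ A B hAB f hf
  have hle : (LinearMap.range φ).map F.subtype ≤ F := Submodule.map_subtype_le _ _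
  obtain ⟨g, hg, hgf⟩ := hF L A B hAB (Submodule.inclusion hle ∘ₗ f)
    ((isCompletelyContractive_inclusion hle).comp hf)
  refine ⟨LinearMap.codRestrict _ (F.subtype ∘ₗ φ ∘ₗ g) fun x =>
    Submodule.mem_map_of_mem ⟨g x, rfl⟩, hφ.comp hg, fun x => Subtype.ext ?_⟩
  obtain ⟨-, ⟨z, rfl⟩, hz⟩ := (f x).2
  have : Submodule.inclusion hle (f x) = φ z := Subtype.ext hz.symm
  change ((φ (g (Submodule.inclusion hAB x)) : F) : K →L[ℂ] K) = f x
  rw [hgf, LinearMap.comp_apply, this, hid]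
  exact hz

end Admissible

/-! ### Rigidity of the injective envelope -/

theorem mainTheorem2
    {H : Type u} [NormedAddCommGroup H] [InnerProductSpace ℂ H] [CompleteSpace H]
    {K : Type v} [NormedAddCommGroup K] [InnerProductSpace ℂ K] [CompleteSpace K]
    (E : OperatorSpace H) (F : OperatorSpace K) (κ : E →ₗ[ℂ] F)
    (hF : IsInjectiveEnvelope E F κ) (θ : F →ₗ[ℂ] F) :
    (IsCompletelyContractive θ ∧ ∀ x : E, θ (κ x) = κ x) ↔ θ = LinearMap.id := by
  constructor
  · rintro ⟨hθ, hfix⟩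
    obtain ⟨φ, hφ, hmin⟩ := exists_minimal_admissible hF.injective (Set.range κ)
    have hiso : ∀ ψ, IsAdmissible (Set.range κ) ψ → ∀ x, ‖φ x‖ ≤ ‖ψ (φ x)‖ := fun ψ hψ =>
      hmin (ψ ∘ₗ φ) (hψ.comp hφ) fun x => hψ.1.norm_le (φ x)
    have hid : ∀ x, φ (φ x) = φ x := fun x =>
      eq_of_norm_admissible_eq hφ (φ x) fun ψ hψ => by
        simpa only [map_sub] using hiso ψ hψ (x - φ x)
    have hrange : (LinearMap.range φ).map F.subtype = F :=
      hF.minimal _ (fun x => ⟨κ x, ⟨κ x, hφ.2 _ ⟨x, rfl⟩⟩, rfl⟩) (Submodule.map_subtype_le _ _)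
        (isInjectiveOperatorSpace_range hF.injective hφ.1 hid)
    have hφid : ∀ x, φ x = x := fun x => by
      obtain ⟨-, ⟨z, rfl⟩, hz⟩ := hrange.ge x.2
      rw [← (Subtype.ext hz : φ z = x), hid]
    have hθ' : IsAdmissible (Set.range κ) θ := ⟨hθ, by rintro _ ⟨x, rfl⟩; exact hfix x⟩
    exact LinearMap.ext fun y => eq_of_norm_admissible_eq hθ' y fun ψ hψ => by
      simpa only [hφid] using hiso ψ hψ (y - θ y)
  · rintro rfl
    exact ⟨isCompletelyContractive_id F, fun _ => rfl⟩
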